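/- Let $L\subset\mathbb{R}^m$ be an $n$-dimensional lattice, i.e. the set of integral linear combinations of $n\ge 1$ linearly independent vectors of $\mathbb{R}^m$. For a basis $b_1,\dots,b_n$ of $L$, let $B$ be the $n\times m$ matrix with rows $b_1,\dots,b_n$, let $b_1^*,\dots,b_n^*$ be the dual basis, i.e. the rows of $(B^+)^t$, where $B^+$ is the Moore–Penrose inverse of $B$, and put $S(B)=\sum_{i=1}^n\|b_i\|^2\,\|b_i^*\|^2$ (Euclidean norms). Let $\mathrm{Vol}\,L=(\det BB^t)^{1/2}$, which does not depend on the choice of the basis. The basis is called Seysen reduced if $S(B)\le S(B')$ for every basis $B'$ of $L$. Proposition 3.7. There is an absolute constant $C$ such that for all $n\ge 1$, all $m$, every $n$-dimensional lattice $L\subset\mathbb{R}^m$ and every Seysen reduced basis $b_1,\dots,b_n$ of $L$, $$\min_{1\le i\le n}\|b_i\|\;\le\;\exp\!\left(\left(\frac{1}{\ln 2}+\frac12\right)(\ln n)^2+C\ln n\right)\cdot(\mathrm{Vol}\,L)^{1/n}.$$ -/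

import Mathlib

namespace Seysen

open Matrix

/-- The `n × m` matrix `B = [b₁ | … | bₙ]ᵗ` whose rows are the vectors `b i` of `ℝᵐ`. -/
def rowMatrix {n m : ℕ} (b : Fin n → EuclideanSpace ℝ (Fin m)) : Matrix (Fin n) (Fin m) ℝ :=
  Matrix.of fun i k => b i k

/-- `b` is a basis of the lattice `L ⊆ ℝᵐ`: its vectors are linearly independent over `ℝ`, and
`L` is the set of their integral linear combinations. The submodules `L` that have a basis in this
sense are exactly the lattices of dimension `n` in `ℝᵐ`. -/
def IsLatticeBasis {n m : ℕ} (L : Submodule ℤ (EuclideanSpace ℝ (Fin m)))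
    (b : Fin n → EuclideanSpace ℝ (Fin m)) : Prop :=
  LinearIndependent ℝ b ∧ Submodule.span ℤ (Set.range b) = L

/-- The number `(det (B Bᵗ)) ^ (1/2)` attached to the rows `b` of `B`. It is the volume of the
lattice of which `b` is a basis; it does not depend on the basis, see `vol_eq_of_isLatticeBasis`. -/
noncomputable def vol {n m : ℕ} (b : Fin n → EuclideanSpace ℝ (Fin m)) : ℝ :=
  Real.sqrt (rowMatrix b * (rowMatrix b)ᵀ).det

/-- The Moore-Penrose inverse `B⁺ = Bᵗ (B Bᵗ)⁻¹` of a matrix `B` with linearly independent rows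
(the only case in which it is used). The Penrose equations are verified in `isPenrose_pinv`. -/
noncomputable def pinv {n m : ℕ} (B : Matrix (Fin n) (Fin m) ℝ) : Matrix (Fin m) (Fin n) ℝ :=
  Bᵀ * (B * Bᵀ)⁻¹

/-- The dual basis `b*`: the rows of `B* = (B⁺)ᵗ`. -/
noncomputable def dual {n m : ℕ} (b : Fin n → EuclideanSpace ℝ (Fin m)) :
    Fin n → EuclideanSpace ℝ (Fin m) :=
  fun i => WithLp.toLp 2 ((pinv (rowMatrix b))ᵀ i)

/-- The Seysen measure `S(B) = ∑ᵢ ‖bᵢ‖² ‖bᵢ*‖²`. -/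
noncomputable def seysenMeasure {n m : ℕ} (b : Fin n → EuclideanSpace ℝ (Fin m)) : ℝ :=
  ∑ i, ‖b i‖ ^ 2 * ‖dual b i‖ ^ 2

/-- `b` is a Seysen reduced basis of `L`: a basis of `L` whose Seysen measure is minimal among
all bases of `L`. -/
def IsSeysenReduced {n m : ℕ} (L : Submodule ℤ (EuclideanSpace ℝ (Fin m)))
    (b : Fin n → EuclideanSpace ℝ (Fin m)) : Prop :=
  IsLatticeBasis L b ∧
    ∀ b' : Fin n → EuclideanSpace ℝ (Fin m), IsLatticeBasis L b' →
      seysenMeasure b ≤ seysenMeasure b'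

/-! Facts that justify the definitions. -/

theorem det_gram_pos {n m : ℕ} {b : Fin n → EuclideanSpace ℝ (Fin m)}
    (hb : LinearIndependent ℝ b) : 0 < (rowMatrix b * (rowMatrix b)ᵀ).det := by
  have h : rowMatrix b * (rowMatrix b)ᵀ = Matrix.gram ℝ b := by
    ext i j
    simp [rowMatrix, Matrix.mul_apply, Matrix.gram, PiLp.inner_apply, mul_comm]
  rw [h]
  exact (Matrix.posDef_gram_of_linearIndependent hb).det_pos

theorem mul_pinv {n m : ℕ} {b : Fin n → EuclideanSpace ℝ (Fin m)}
    (hb : LinearIndependent ℝ b) : rowMatrix b * pinv (rowMatrix b) = 1 := by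
  rw [pinv, ← Matrix.mul_assoc]
  exact Matrix.mul_nonsing_inv _ (isUnit_iff_ne_zero.2 (det_gram_pos hb).ne')

/-- The four equations that characterize the Moore-Penrose inverse. -/
theorem isPenrose_pinv {n m : ℕ} {b : Fin n → EuclideanSpace ℝ (Fin m)}
    (hb : LinearIndependent ℝ b) :
    rowMatrix b * pinv (rowMatrix b) * rowMatrix b = rowMatrix b ∧
    pinv (rowMatrix b) * rowMatrix b * pinv (rowMatrix b) = pinv (rowMatrix b) ∧
    (rowMatrix b * pinv (rowMatrix b))ᵀ = rowMatrix b * pinv (rowMatrix b) ∧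
    (pinv (rowMatrix b) * rowMatrix b)ᵀ = pinv (rowMatrix b) * rowMatrix b := by
  refine ⟨?_, ?_, ?_, ?_⟩
  · rw [mul_pinv hb, Matrix.one_mul]
  · rw [Matrix.mul_assoc, mul_pinv hb, Matrix.mul_one]
  · rw [mul_pinv hb, Matrix.transpose_one]
  · simp [pinv, Matrix.transpose_mul, Matrix.transpose_nonsing_inv, Matrix.mul_assoc]

/-- `⟨bᵢ, bⱼ*⟩ = δᵢⱼ`. -/
theorem inner_dual {n m : ℕ} {b : Fin n → EuclideanSpace ℝ (Fin m)}
    (hb : LinearIndependent ℝ b) (i j : Fin n) :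
    inner ℝ (b i) (dual b j) = if i = j then 1 else 0 := by
  rw [← Matrix.one_apply, ← mul_pinv hb]
  simp [dual, rowMatrix, Matrix.mul_apply, PiLp.inner_apply, mul_comm]

theorem exists_int_matrix {n m : ℕ} {b b' : Fin n → EuclideanSpace ℝ (Fin m)}
    (h : ∀ i, b' i ∈ Submodule.span ℤ (Set.range b)) :
    ∃ P : Matrix (Fin n) (Fin n) ℤ, rowMatrix b' = P.map (Int.cast : ℤ → ℝ) * rowMatrix b := by
  choose P hP using fun i => (Submodule.mem_span_range_iff_exists_fun ℤ).1 (h i)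
  refine ⟨Matrix.of P, ?_⟩
  ext i k
  simp [rowMatrix, Matrix.mul_apply, ← hP i]

/-- The volume of a lattice is well defined. -/
theorem vol_eq_of_isLatticeBasis {n m : ℕ} {L : Submodule ℤ (EuclideanSpace ℝ (Fin m))}
    {b b' : Fin n → EuclideanSpace ℝ (Fin m)} (hb : IsLatticeBasis L b)
    (hb' : IsLatticeBasis L b') : vol b = vol b' := by
  obtain ⟨P, hP⟩ := exists_int_matrix (b := b) (b' := b') fun i => by
    rw [hb.2, ← hb'.2]; exact Submodule.subset_span ⟨i, rfl⟩
  obtain ⟨Q, hQ⟩ := exists_int_matrix (b := b') (b' := b) fun i => by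
    rw [hb'.2, ← hb.2]; exact Submodule.subset_span ⟨i, rfl⟩
  have h1 : Q.map (Int.cast : ℤ → ℝ) * P.map (Int.cast : ℤ → ℝ) = 1 := by
    have h := congrArg (· * pinv (rowMatrix b)) hQ
    simp only [hP] at h
    rw [mul_pinv hb.1, Matrix.mul_assoc, Matrix.mul_assoc, mul_pinv hb.1, Matrix.mul_one] at h
    exact h.symm
  have h2 : (Q.det : ℝ) * (P.det : ℝ) = 1 := by
    have h := congrArg Matrix.det h1
    rw [Matrix.det_mul, Matrix.det_one] at h
    rw [Int.cast_det, Int.cast_det]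
    exact h
  have h3 : (P.det : ℝ) * (P.det : ℝ) = 1 := by
    have h : Q.det * P.det = 1 := by exact_mod_cast h2
    exact_mod_cast Int.isUnit_mul_self (IsUnit.of_mul_eq_one_right _ h)
  have h4 : (P.map (Int.cast : ℤ → ℝ)).det = (P.det : ℝ) := (Int.cast_det P).symm
  have h5 : (rowMatrix b' * (rowMatrix b')ᵀ).det = (rowMatrix b * (rowMatrix b)ᵀ).det := by
    have h : rowMatrix b' * (rowMatrix b')ᵀ = P.map (Int.cast : ℤ → ℝ) *
        (rowMatrix b * (rowMatrix b)ᵀ) * (P.map (Int.cast : ℤ → ℝ))ᵀ := by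
      rw [hP, Matrix.transpose_mul]
      simp only [Matrix.mul_assoc]
    rw [h, Matrix.det_mul, Matrix.det_mul, Matrix.det_transpose, h4, mul_right_comm, h3, one_mul]
  rw [vol, vol, h5]

end Seysen

/-!
Write `G` for the Gram matrix of a basis `b` of the lattice, so that `S(b) = ∑ i, G i i * G⁻¹ i i`. The
arithmetic-geometric mean inequality for the eigenvalues of a scaled inverse of `G` gives
`∏ i, ‖b i‖² ≤ (S(b) / n) ^ n * vol b ^ 2` (`prod_diag_le`, `iInf_norm_pow_le`). For a Seysen reduced
basis `S(b)` is at most the Seysen measure of any other basis, so it suffices to exhibit one basis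
whose measure is at most `exp ((2 / log 2 + 1) (log n)² + O(log n))`.

Take a Korkin-Zolotarev reduced basis (`exists_isKorkinZolotarev`). Minkowski's theorem, applied to
the blocks of consecutive vectors, shows that its squared Gram-Schmidt norms `c j` satisfy
`c j / c k ≤ n ^ (2 + log n)` for `j ≤ k` (`IsKorkinZolotarev.div_le`). Its matrix of coordinates in the
Gram-Schmidt vectors is lower unitriangular, and a unimodular change of basis makes it a matrix `W`,
still lower triangular, such that the entries of `W` and of `V = W⁻¹` are at most `2 ^ (k choose 2)`,
where `2 ^ k` is the least power of two that is at least `n` (`exists_int_unimodular_mul_le`). The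
Seysen measure of the new basis is the sum of the `(W i j)² (V k i)² c j / c k`, where only the terms
with `j ≤ i ≤ k` do not vanish (`sum_mul_sum_le`). The entries contribute `2 / log 2` to the coefficient
of `(log n)²`, the decay of the `c j` contributes `1`.
-/

namespace Seysen

open Matrix

/-! ### Minkowski's theorem and two elementary inequalities -/

/-- Minkowski's theorem on linear forms: at some nonzero integer point all the `n` forms given by
the columns of `A` are at most `|det A| ^ (1 / n)`, where `n` is the size of `A`. The convex body is a
closed cube, for which equality of volumes is allowed. -/
theorem exists_int_vecMul_pow_le {ι : Type*} [Fintype ι] [DecidableEq ι] [Nonempty ι]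
    (A : Matrix ι ι ℝ) (hA : A.det ≠ 0) :
    ∃ z : ι → ℤ, z ≠ 0 ∧ ∀ j, |∑ k, (z k : ℝ) * A k j| ^ Fintype.card ι ≤ |A.det| := by
  have hli : LinearIndependent ℝ A.row :=
    Matrix.linearIndependent_rows_iff_isUnit.2 ((Matrix.isUnit_iff_isUnit_det A).2 hA.isUnit)
  let b : Module.Basis ι ℝ (ι → ℝ) := basisOfLinearIndependentOfCardEqFinrank hli (by simp)
  have hb : (b : ι → ι → ℝ) = A.row := coe_basisOfLinearIndependentOfCardEqFinrank hli _
  have hcard : Fintype.card ι ≠ 0 := Fintype.card_ne_zero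
  set r : ℝ := |A.det| ^ (1 / Fintype.card ι : ℝ) with hr
  have hr0 : 0 ≤ r := by positivity
  have hrpow : r ^ Fintype.card ι = |A.det| := by
    rw [hr, one_div, Real.rpow_inv_natCast_pow (abs_nonneg _) hcard]
  have hvol : MeasureTheory.volume (ZSpan.fundamentalDomain b) *
      2 ^ Module.finrank ℝ (ι → ℝ) ≤
      MeasureTheory.volume (Metric.closedBall (0 : ι → ℝ) r) := by
    rw [ZSpan.volume_fundamentalDomain, hb, Real.volume_pi_closedBall _ hr0, mul_pow, hrpow,
      Module.finrank_fintype_fun_eq_card, mul_comm, ENNReal.ofReal_mul (by positivity),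
      ENNReal.ofReal_pow (by norm_num), ENNReal.ofReal_ofNat]
    exact le_rfl
  have : Countable (Submodule.span ℤ (Set.range b)).toAddSubgroup :=
    inferInstanceAs (Countable (Submodule.span ℤ (Set.range b)))
  have : DiscreteTopology (Submodule.span ℤ (Set.range b)).toAddSubgroup :=
    inferInstanceAs (DiscreteTopology (Submodule.span ℤ (Set.range b)))
  obtain ⟨⟨x, hx⟩, hx0, hxs⟩ :=
    MeasureTheory.exists_ne_zero_mem_lattice_of_measure_mul_two_pow_le_measure
      (L := (Submodule.span ℤ (Set.range b)).toAddSubgroup)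
      (ZSpan.isAddFundamentalDomain' b MeasureTheory.volume)
      (by simp) (convex_closedBall _ _) (isCompact_closedBall _ _) hvol
  obtain ⟨z, rfl⟩ := (Submodule.mem_span_range_iff_exists_fun ℤ).1 hx
  refine ⟨z, ?_, fun j => ?_⟩
  · rintro rfl
    exact hx0 (by simp)
  · rw [← hrpow]
    gcongr
    have h := (pi_norm_le_iff_of_nonneg hr0).1 (mem_closedBall_zero_iff.1 hxs) j
    simpa [hb, Finset.sum_apply, Matrix.row] using h

theorem det_le_trace_div_pow {n : ℕ} (hn : n ≠ 0) {M : Matrix (Fin n) (Fin n) ℝ}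
    (hM : M.PosSemidef) : M.det ≤ (M.trace / n) ^ n := by
  have hev := hM.eigenvalues_nonneg
  have h := Real.geom_mean_le_arith_mean Finset.univ (fun _ : Fin n => (1 : ℝ))
    hM.isHermitian.eigenvalues (by simp) (by simpa using Nat.pos_of_ne_zero hn) (fun i _ => hev i)
  rw [hM.isHermitian.det_eq_prod_eigenvalues, hM.isHermitian.trace_eq_sum_eigenvalues]
  simp only [Real.rpow_one, one_mul, Finset.sum_const, Finset.card_univ, Fintype.card_fin,
    nsmul_eq_mul, mul_one] at h
  have hprod := Finset.prod_nonneg fun i (_ : i ∈ Finset.univ) => hev i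
  have h2 := pow_le_pow_left₀ (Real.rpow_nonneg hprod _) h n
  rw [Real.rpow_inv_natCast_pow hprod hn] at h2
  simpa using h2

/-- The arithmetic-geometric mean inequality for the eigenvalues of `D G⁻¹ D`, where `D` is the
diagonal matrix of the square roots of the `G i i`: its trace is `∑ i, G i i * G⁻¹ i i`, the Seysen
measure of a basis with Gram matrix `G`, and its determinant is `(∏ i, G i i) / det G`. -/
theorem prod_diag_le {n : ℕ} (hn : n ≠ 0) {G : Matrix (Fin n) (Fin n) ℝ} (hG : G.PosDef) :
    ∏ i, G i i ≤ ((∑ i, G i i * G⁻¹ i i) / n) ^ n * G.det := by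
  have hd : ∀ i, 0 ≤ G i i := fun i => hG.diag_pos.le
  let D : Matrix (Fin n) (Fin n) ℝ := Matrix.diagonal fun i => Real.sqrt (G i i)
  have hM : (Dᴴ * G⁻¹ * D).PosSemidef := hG.inv.posSemidef.conjTranspose_mul_mul_same D
  have h := det_le_trace_div_pow hn hM
  have h1 : (Dᴴ * G⁻¹ * D).trace = ∑ i, G i i * G⁻¹ i i := by
    simp only [D, Matrix.trace, Matrix.diag, Matrix.diagonal_conjTranspose, Matrix.mul_diagonal,
      Matrix.diagonal_mul]
    refine Finset.sum_congr rfl fun i _ => ?_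
    simp only [Pi.star_apply, star_trivial]
    rw [mul_right_comm, Real.mul_self_sqrt (hd i)]
  have h2 : (Dᴴ * G⁻¹ * D).det * G.det = ∏ i, G i i := by
    have h3 : D.det * D.det = ∏ i, G i i := by
      rw [Matrix.det_diagonal, ← Finset.prod_mul_distrib]
      exact Finset.prod_congr rfl fun i _ => Real.mul_self_sqrt (hd i)
    have h4 : (G⁻¹).det * G.det = 1 := by
      rw [← Matrix.det_mul, Matrix.nonsing_inv_mul _ hG.det_pos.ne'.isUnit, Matrix.det_one]
    rw [Matrix.det_mul, Matrix.det_mul, Matrix.det_conjTranspose, star_trivial, ← h3]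
    linear_combination D.det * D.det * h4
  rw [← h2, ← h1]
  exact mul_le_mul_of_nonneg_right h hG.det_pos.le

/-- The recursion satisfied by the logarithms of the norms of a Korkin-Zolotarev reduced basis,
counted from the last vector backwards. The proof bounds the partial sums of `y`: divided by their
length they grow by at most `M / t` in each step. -/
theorem le_mul_one_add_harmonic {M : ℝ} (y : ℕ → ℝ) (N : ℕ) (h0 : y 0 ≤ 0)
    (h : ∀ t ≤ N, t * y t ≤ (t + 1) * M + ∑ u ∈ Finset.range t, y u) :
    ∀ t ≤ N, t ≠ 0 → y t ≤ M * (1 + harmonic t) := by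
  have hS : ∀ t ≤ N, ∑ u ∈ Finset.range (t + 1), y u ≤ (t + 1) * (M * harmonic t) := by
    intro t
    induction t with
    | zero => intro _; simpa using h0
    | succ t ih =>
      intro ht
      have h1 := ih (by omega)
      have h2 := h (t + 1) ht
      rw [Finset.sum_range_succ, harmonic_succ]
      push_cast at h2 ⊢
      set s := ∑ u ∈ Finset.range (t + 1), y u
      have ht0 : (0 : ℝ) < t + 1 := by positivity
      refine le_of_mul_le_mul_left ?_ ht0
      have e : ((t : ℝ) + 1) * ((t + 1 + 1) * (M * (harmonic t + (t + 1 : ℝ)⁻¹))) =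
        (t + 2) * ((t + 1) * (M * harmonic t)) + (t + 2) * M := by
        field_simp
        ring
      rw [e]
      nlinarith
  intro t ht ht0
  obtain ⟨t, rfl⟩ := Nat.exists_eq_succ_of_ne_zero ht0
  have h1 := hS t (by omega)
  have h2 := h (t + 1) ht
  rw [Nat.succ_eq_add_one, harmonic_succ]
  push_cast at h2 ⊢
  have hp : (0 : ℝ) < t + 1 := by positivity
  refine le_of_mul_le_mul_left (h2.trans ?_) hp
  have e : ((t : ℝ) + 1) * (M * (1 + (harmonic t + (t + 1 : ℝ)⁻¹))) =
    (t + 1) * (M * harmonic t) + (t + 2) * M := by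
    field_simp
    ring
  rw [e]
  linarith

/-! ### Korkin-Zolotarev reduced bases -/

theorem exists_shortest {ι E : Type*} [Fintype ι] [Nonempty ι] [NormedAddCommGroup E]
    [NormedSpace ℝ E] {b : ι → E} (hb : LinearIndependent ℝ b) :
    ∃ z : ι → ℤ, z ≠ 0 ∧ ∀ w : ι → ℤ, w ≠ 0 →
      ‖∑ k, (z k : ℝ) • b k‖ ≤ ‖∑ k, (w k : ℝ) • b k‖ := by
  classical
  obtain ⟨K, -, hK⟩ := (Fintype.linearCombination ℝ b).exists_antilipschitzWith
    (LinearMap.ker_eq_bot.2 hb.fintypeLinearCombination_injective)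
  let f : (ι → ℤ) → ℝ := fun z => ‖∑ k, (z k : ℝ) • b k‖
  obtain ⟨z₀, hz₀⟩ : ∃ z : ι → ℤ, z ≠ 0 := exists_ne 0
  have hfin : {z : ι → ℤ | z ≠ 0 ∧ f z ≤ f z₀}.Finite := by
    obtain ⟨N, hN⟩ := exists_nat_ge (K * f z₀)
    refine (Set.finite_Icc (fun _ : ι => -(N : ℤ)) (fun _ => (N : ℤ))).subset ?_
    rintro z ⟨-, hz⟩
    have h1 : ∀ i, |(z i : ℝ)| ≤ N := fun i => by
      have h2 := hK.le_mul_dist (fun i => (z i : ℝ)) 0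
      rw [dist_zero_right, map_zero, dist_zero_right, Fintype.linearCombination_apply] at h2
      have h3 := norm_le_pi_norm (fun i => (z i : ℝ)) i
      rw [Real.norm_eq_abs] at h3
      exact h3.trans (h2.trans ((mul_le_mul_of_nonneg_left hz K.2).trans hN))
    have h2 : ∀ i, |z i| ≤ N := fun i => by exact_mod_cast h1 i
    exact ⟨fun i => (abs_le.1 (h2 i)).1, fun i => (abs_le.1 (h2 i)).2⟩
  obtain ⟨z, ⟨hz, hz'⟩, hmin⟩ := Set.exists_min_image _ f hfin ⟨z₀, hz₀, le_rfl⟩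
  refine ⟨z, hz, fun w hw => ?_⟩
  by_cases h : f w ≤ f z₀
  · exact hmin w ⟨hw, h⟩
  · exact hz'.trans (not_le.1 h).le

theorem exists_basis_smul_eq {R M ι : Type*} [CommRing R] [IsDomain R] [IsPrincipalIdealRing R]
    [AddCommGroup M] [Module R M] [Finite ι] (b : Module.Basis ι R M) {z : M} (hz : z ≠ 0) :
    ∃ (b' : Module.Basis ι R M) (c : R) (i : ι), z = c • b' i := by
  obtain ⟨d, bM, bN, f, a, snf⟩ := Submodule.smithNormalForm b (Submodule.span R {z})
  have hzmem := Submodule.mem_span_singleton_self (R := R) z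
  have hd : Nonempty (Fin d) := by
    by_contra hd
    rw [not_nonempty_iff] at hd
    have h : (⟨z, hzmem⟩ : Submodule.span R {z}) = 0 := bN.repr.injective (Subsingleton.elim _ _)
    exact hz (congrArg Subtype.val h)
  obtain ⟨i⟩ := hd
  have hsub : ∀ j, j = i := fun j => by
    have h := Module.finrank_eq_card_basis bN
    have h1 := finrank_span_le_card (R := R) ({z} : Set M)
    rw [h, Fintype.card_fin, Set.toFinset_singleton, Finset.card_singleton] at h1
    exact Fin.ext (by omega)
  have h := congrArg Subtype.val (bN.sum_repr ⟨z, hzmem⟩)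
  have : Unique (Fin d) := ⟨⟨i⟩, hsub⟩
  rw [Fintype.sum_unique, Submodule.coe_smul, snf, smul_smul] at h
  exact ⟨bM, _, _, h.symm⟩

/-- A shortest nonzero vector of a lattice can be taken as the first vector of a basis. No notion of
primitive vector is needed: a shortest vector is a multiple `c • v` of a member `v` of some basis,
and then `v` is at most as long. -/
theorem exists_unimodular_shortest {n : ℕ} {E : Type*} [NormedAddCommGroup E]
    [NormedSpace ℝ E] {b : Fin (n + 1) → E} (hb : LinearIndependent ℝ b) :
    ∃ P : Matrix (Fin (n + 1)) (Fin (n + 1)) ℤ, IsUnit P.det ∧ ∀ w : Fin (n + 1) → ℤ, w ≠ 0 →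
      ‖∑ k, (P 0 k : ℝ) • b k‖ ≤ ‖∑ k, (w k : ℝ) • b k‖ := by
  obtain ⟨z, hz, hmin⟩ := exists_shortest hb
  obtain ⟨bM, c, i, hc⟩ := exists_basis_smul_eq (Pi.basisFun ℤ (Fin (n + 1))) hz
  have hc0 : c ≠ 0 := by rintro rfl; exact hz (by simpa using hc)
  let e := bM.reindex (Equiv.swap i 0)
  refine ⟨Matrix.of e, ?_, fun w hw => le_trans ?_ (hmin w hw)⟩
  · have h : IsUnit ((Matrix.of e)ᵀ).det := (Pi.basisFun ℤ (Fin (n + 1))).isUnit_det e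
    rwa [Matrix.det_transpose] at h
  · have he : e 0 = bM i := by simp [e]
    have h : ∑ k, (z k : ℝ) • b k = (c : ℝ) • ∑ k, (bM i k : ℝ) • b k := by
      rw [hc, Finset.smul_sum]
      simp [smul_smul]
    rw [h, norm_smul]
    simp only [Matrix.of_apply, he]
    refine le_mul_of_one_le_left (norm_nonneg _) ?_
    rw [Real.norm_eq_abs]
    exact_mod_cast Int.one_le_abs hc0

/-- `U` and `c` describe a Korkin-Zolotarev reduced basis `bᵢ = ∑ j, U i j • eⱼ`, where the `eⱼ` are its
Gram-Schmidt vectors and `c j = ‖eⱼ‖²`. So `U` is lower unitriangular, and `eᵢ` is a shortest nonzero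
vector of the projection of the lattice orthogonal to `e₀, …, eᵢ₋₁`; `short` says this for the
sublattice of the integral combinations of `bᵢ, bᵢ₊₁, …`, whose projection is the same. -/
structure IsKorkinZolotarev {n : ℕ} (U : Matrix (Fin n) (Fin n) ℝ) (c : Fin n → ℝ) : Prop where
  lower : ∀ i j, i < j → U i j = 0
  diag : ∀ i, U i i = 1
  pos : ∀ i, 0 < c i
  short : ∀ (i : Fin n) (z : Fin n → ℤ), (∀ k < i, z k = 0) → z ≠ 0 →
    c i ≤ ∑ j with i ≤ j, (∑ k, (z k : ℝ) * U k j) ^ 2 * c j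

theorem norm_sq_sum_of_orthogonal {ι E : Type*} [Fintype ι] [NormedAddCommGroup E]
    [InnerProductSpace ℝ E] {e : ι → E} (he : Pairwise fun i j => inner ℝ (e i) (e j) = 0)
    (a : ι → ℝ) : ‖∑ j, a j • e j‖ ^ 2 = ∑ j, a j ^ 2 * ‖e j‖ ^ 2 := by
  rw [← real_inner_self_eq_norm_sq, sum_inner]
  refine Finset.sum_congr rfl fun i _ => ?_
  rw [inner_sum, Finset.sum_eq_single i]
  · rw [real_inner_smul_left, real_inner_smul_right, real_inner_self_eq_norm_sq]
    ring
  · intro j _ hj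
    rw [real_inner_smul_left, real_inner_smul_right, he hj.symm, mul_zero, mul_zero]
  · simp

theorem sum_smul_sum_mul_smul {ι κ E : Type*} [Fintype ι] [Fintype κ] [AddCommGroup E]
    [Module ℝ E] (a : ι → ℝ) (U : Matrix ι κ ℝ) (e : κ → E) :
    ∑ i, a i • ∑ j, U i j • e j = ∑ j, (∑ i, a i * U i j) • e j := by
  simp_rw [Finset.smul_sum, Finset.sum_smul, smul_smul]
  exact Finset.sum_comm

theorem intCast_det_ne_zero {ι : Type*} [Fintype ι] [DecidableEq ι] {P : Matrix ι ι ℤ}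
    (hP : IsUnit P.det) : (P.map (Int.cast : ℤ → ℝ)).det ≠ 0 := by
  have h : (P.map (Int.cast : ℤ → ℝ)).det = (P.det : ℝ) := (Int.cast_det P).symm
  rw [h]
  exact_mod_cast hP.ne_zero

theorem linearIndependent_sum_smul {ι E : Type*} [Fintype ι] [DecidableEq ι] [AddCommGroup E]
    [Module ℝ E] {b : ι → E} (hb : LinearIndependent ℝ b) {P : Matrix ι ι ℝ} (hP : P.det ≠ 0) :
    LinearIndependent ℝ fun i => ∑ j, P i j • b j := by
  rw [Fintype.linearIndependent_iff] at hb ⊢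
  intro a ha
  rw [sum_smul_sum_mul_smul] at ha
  exact congrFun (Matrix.eq_zero_of_vecMul_eq_zero hP (funext fun j => hb _ ha j))

theorem det_of_cons_cons {n : ℕ} {R : Type*} [CommRing R] (P : Matrix (Fin n) (Fin n) R) :
    (Matrix.of (Fin.cons (Fin.cons 1 0) fun i => Fin.cons 0 (P i) :
      Fin (n + 1) → Fin (n + 1) → R)).det = P.det := by
  rw [Matrix.det_succ_row_zero, Fin.sum_univ_succ]
  simp only [of_apply, Fin.cons_zero, Fin.cons_succ, Pi.zero_apply, mul_zero, zero_mul,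
    Finset.sum_const_zero, add_zero, Fin.val_zero, pow_zero, mul_one, one_mul]
  congr 1

/-- Every lattice has a Korkin-Zolotarev reduced basis. Its first vector is a shortest one, the others
are lifts of a reduced basis of the projection orthogonal to it. The clause on vectors orthogonal to
all `b i` says that the `e i` lie in the span of `b`; the induction needs it to see that the first
vector is orthogonal to the later `e i`. -/
theorem exists_isKorkinZolotarev {E : Type*} [NormedAddCommGroup E] [InnerProductSpace ℝ E] :
    ∀ {n : ℕ} {b : Fin n → E}, LinearIndependent ℝ b →
      ∃ (P : Matrix (Fin n) (Fin n) ℤ) (U : Matrix (Fin n) (Fin n) ℝ) (e : Fin n → E),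
        IsUnit P.det ∧ IsKorkinZolotarev U (fun i => ‖e i‖ ^ 2) ∧
        (Pairwise fun i j => inner ℝ (e i) (e j) = 0) ∧
        (∀ v : E, (∀ i, inner ℝ v (b i) = 0) → ∀ i, inner ℝ v (e i) = 0) ∧
        ∀ i, ∑ j, (P i j : ℝ) • b j = ∑ j, U i j • e j := by
  intro n
  induction n with
  | zero =>
    intro b _
    exact ⟨1, 1, b, by simp, ⟨fun i => i.elim0, fun i => i.elim0, fun i => i.elim0,
      fun i => i.elim0⟩, fun i => i.elim0, fun _ _ i => i.elim0, fun i => i.elim0⟩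
  | succ n ih =>
    intro b hb
    obtain ⟨P₀, hP₀, hmin⟩ := exists_unimodular_shortest hb
    let v : Fin (n + 1) → E := fun i => ∑ j, (P₀ i j : ℝ) • b j
    have hv : LinearIndependent ℝ v := linearIndependent_sum_smul hb (intCast_det_ne_zero hP₀)
    have hv0 : v 0 ≠ 0 := hv.ne_zero 0
    let μ : Fin n → ℝ := fun i => inner ℝ (v 0) (v i.succ) / ‖v 0‖ ^ 2
    let w : Fin n → E := fun i => v i.succ - μ i • v 0
    have hvw : ∀ i, v i.succ = w i + μ i • v 0 := fun i => by simp [w]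
    have horth : ∀ i, inner ℝ (v 0) (w i) = 0 := fun i => by
      have : ‖v 0‖ ^ 2 ≠ 0 := pow_ne_zero _ (norm_ne_zero_iff.2 hv0)
      simp only [w, μ, inner_sub_right, real_inner_smul_right, real_inner_self_eq_norm_sq]
      field_simp
      ring
    have hw : LinearIndependent ℝ w := by
      rw [Fintype.linearIndependent_iff] at hv ⊢
      intro a ha i
      have h := hv (Fin.cons (-∑ j, a j * μ j) a) (by
        rw [Fin.sum_univ_succ]
        simp only [Fin.cons_zero, Fin.cons_succ, hvw, smul_add, Finset.sum_add_distrib, ha,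
          smul_smul, ← Finset.sum_smul]
        rw [zero_add, ← add_smul, neg_add_cancel, zero_smul]) i.succ
      simpa using h
    obtain ⟨P, U, e, hP, hU, he, hperp, hPU⟩ := ih hw
    let Q : Matrix (Fin (n + 1)) (Fin (n + 1)) ℤ :=
      Matrix.of (Fin.cons (Fin.cons 1 0) fun i => Fin.cons 0 (P i))
    let U' : Matrix (Fin (n + 1)) (Fin (n + 1)) ℝ :=
      Matrix.of (Fin.cons (Fin.cons 1 0) fun i => Fin.cons (∑ j, (P i j : ℝ) * μ j) (U i))
    let e' : Fin (n + 1) → E := Fin.cons (v 0) e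
    have he' : Pairwise fun i j => inner ℝ (e' i) (e' j) = 0 := by
      intro i j hij
      induction i using Fin.cases with
      | zero =>
        induction j using Fin.cases with
        | zero => exact absurd rfl hij
        | succ j => exact hperp _ horth j
      | succ i =>
        induction j using Fin.cases with
        | zero => rw [real_inner_comm]; exact hperp _ horth i
        | succ j => exact he fun h => hij (congrArg _ h)
    have hQ : IsUnit (Q * P₀).det := by
      rw [Matrix.det_mul, det_of_cons_cons]
      exact hP.mul hP₀
    have hQU : ∀ i, ∑ j, ((Q * P₀) i j : ℝ) • b j = ∑ j, U' i j • e' j := by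
      intro i
      have h1 : ∑ j, ((Q * P₀) i j : ℝ) • b j = ∑ k, (Q i k : ℝ) • v k := by
        simp only [v]
        refine .trans ?_ (sum_smul_sum_mul_smul (fun k => (Q i k : ℝ))
          (P₀.map (Int.cast : ℤ → ℝ)) b).symm
        simp [Matrix.mul_apply]
      rw [h1]
      induction i using Fin.cases with
      | zero => simp [Fin.sum_univ_succ, Q, U', e']
      | succ i =>
        simp only [Fin.sum_univ_succ, Q, U', e', Matrix.of_apply, Fin.cons_succ, Fin.cons_zero,
          Int.cast_zero, zero_smul, zero_add, ← hPU, hvw, smul_add, Finset.sum_add_distrib,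
          smul_smul, Finset.sum_smul]
        rw [add_comm]
    refine ⟨Q * P₀, U', e', hQ, ⟨?_, ?_, ?_, ?_⟩, he', ?_, hQU⟩
    · intro i j hij
      induction j using Fin.cases with
      | zero => exact absurd hij (Fin.not_lt_zero _)
      | succ j =>
        induction i using Fin.cases with
        | zero => rfl
        | succ i => exact hU.lower i j (Fin.succ_lt_succ_iff.1 hij)
    · intro i
      induction i using Fin.cases with
      | zero => rfl
      | succ i => exact hU.diag i
    · intro i
      induction i using Fin.cases with
      | zero => exact pow_pos (norm_pos_iff.2 hv0) 2
      | succ i => exact hU.pos i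
    · intro i z hz hz0
      induction i using Fin.cases with
      | zero =>
        have h1 : ∑ j with 0 ≤ j, (∑ k, (z k : ℝ) * U' k j) ^ 2 * ‖e' j‖ ^ 2 =
            ‖∑ k, ((z ᵥ* (Q * P₀)) k : ℝ) • b k‖ ^ 2 := by
          rw [Finset.filter_true_of_mem fun j _ => Fin.zero_le j,
            ← norm_sq_sum_of_orthogonal he', ← sum_smul_sum_mul_smul]
          simp only [← hQU]
          congr 2
          refine (sum_smul_sum_mul_smul (fun k => (z k : ℝ))
            ((Q * P₀).map (Int.cast : ℤ → ℝ)) b).trans ?_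
          simp [Matrix.vecMul, dotProduct]
        rw [h1]
        gcongr
        refine hmin _ fun h => hz0 (Matrix.eq_zero_of_vecMul_eq_zero hQ.ne_zero h)
      | succ i =>
        have hz00 : z 0 = 0 := hz 0 (Fin.succ_pos i)
        have h1 := hU.short i (fun k => z k.succ)
          (fun k hk => hz _ (Fin.succ_lt_succ_iff.2 hk)) (fun h => hz0 (by
            ext k
            induction k using Fin.cases with
            | zero => exact hz00
            | succ k => exact congrFun h k))
        refine h1.trans_eq ?_
        rw [Finset.sum_filter, Finset.sum_filter, Fin.sum_univ_succ]
        simp [Fin.sum_univ_succ, U', e', hz00]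
    · intro x hx i
      have hxv : ∀ i, inner ℝ x (v i) = 0 := fun i => by
        simp [v, inner_sum, real_inner_smul_right, hx]
      induction i using Fin.cases with
      | zero => exact hxv 0
      | succ i =>
        refine hperp x (fun i => ?_) i
        simp [w, inner_sub_right, real_inner_smul_right, hxv]

/-! ### The decay of the Gram-Schmidt norms -/

theorem sum_eq_sum_subtype {ι : Type*} [Fintype ι] (p : ι → Prop) [DecidablePred p] (f : ι → ℝ)
    (h : ∀ k, ¬p k → f k = 0) : ∑ k, f k = ∑ k : {k // p k}, f k := by
  rw [← Fintype.sum_subtype_add_sum_subtype p f, Finset.sum_eq_zero (s := Finset.univ)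
    (f := fun k : {k // ¬p k} => f k) fun k _ => h k k.2, add_zero]

/-- Minkowski's theorem for the block of a Korkin-Zolotarev reduced basis between `i` and `j`, of
length `s`: Hermite's constant in dimension `s` is at most `s`. -/
theorem IsKorkinZolotarev.pow_card_le {n : ℕ} {U : Matrix (Fin n) (Fin n) ℝ} {c : Fin n → ℝ}
    (h : IsKorkinZolotarev U c) {i j : Fin n} (hij : i ≤ j) :
    c i ^ Fintype.card {k // i ≤ k ∧ k ≤ j} ≤
      (Fintype.card {k // i ≤ k ∧ k ≤ j} : ℝ) ^ Fintype.card {k // i ≤ k ∧ k ≤ j} *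
        ∏ k : {k // i ≤ k ∧ k ≤ j}, c k := by
  set p : Fin n → Prop := fun k => i ≤ k ∧ k ≤ j with hp
  have : Nonempty {k // p k} := ⟨⟨i, le_rfl, hij⟩⟩
  let A : Matrix {k // p k} {k // p k} ℝ := Matrix.of fun a b => U a b * Real.sqrt (c b)
  have hdet : A.det = ∏ k : {k // p k}, Real.sqrt (c k) := by
    rw [Matrix.det_of_isLowerTriangular A fun a b hab => by
      simp [A, h.lower a b (show (a : Fin n) < b from hab)]]
    exact Finset.prod_congr rfl fun k _ => by simp [A, h.diag]
  have hdet0 : 0 < A.det := by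
    rw [hdet]
    exact Finset.prod_pos fun k _ => Real.sqrt_pos.2 (h.pos k)
  have hdetsq : A.det ^ 2 = ∏ k : {k // p k}, c k := by
    rw [hdet, ← Finset.prod_pow]
    exact Finset.prod_congr rfl fun k _ => Real.sq_sqrt (h.pos k).le
  obtain ⟨z, hz0, hz⟩ := exists_int_vecMul_pow_le A hdet0.ne'
  rw [abs_of_pos hdet0] at hz
  let z' : Fin n → ℤ := fun k => if hk : p k then z ⟨k, hk⟩ else 0
  have hz' : ∀ k : {k // p k}, z' k = z k := fun k => dif_pos k.2
  have hz'0 : ∀ k, ¬p k → z' k = 0 := fun k hk => dif_neg hk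
  have hsum : ∀ l, ∑ k, (z' k : ℝ) * U k l = ∑ k : {k // p k}, (z k : ℝ) * U k l := fun l => by
    rw [sum_eq_sum_subtype p _ fun k hk => by rw [hz'0 k hk, Int.cast_zero, zero_mul]]
    simp only [hz']
  have hshort := h.short i z' (fun k hk => hz'0 k fun hk' => absurd hk'.1 (not_le.2 hk))
    (fun h0 => hz0 (funext fun k => by rw [← hz', h0]; rfl))
  have hle : c i ≤ ∑ b, (∑ a, (z a : ℝ) * A a b) ^ 2 := by
    refine hshort.trans_eq ?_
    rw [Finset.sum_filter, sum_eq_sum_subtype p]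
    · refine Finset.sum_congr rfl fun b _ => ?_
      rw [if_pos b.2.1, hsum]
      simp only [A, Matrix.of_apply, ← mul_assoc, ← Finset.sum_mul]
      rw [mul_pow, Real.sq_sqrt (h.pos b).le]
    · -- Beyond `j` the rows of the block vanish, because `U` is lower triangular.
      intro l hl
      split_ifs with hil
      · have hjl : j < l := not_le.1 fun hlj => hl ⟨hil, hlj⟩
        rw [hsum, Finset.sum_eq_zero fun k _ => by
          rw [h.lower k l (k.2.2.trans_lt hjl), mul_zero]]
        simp
      · rfl
  obtain ⟨b, -, hb⟩ := Finset.exists_max_image Finset.univ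
    (fun b => (∑ a, (z a : ℝ) * A a b) ^ 2) Finset.univ_nonempty
  have hle' : c i ≤ Fintype.card {k // p k} * (∑ a, (z a : ℝ) * A a b) ^ 2 := by
    refine hle.trans ((Finset.sum_le_card_nsmul _ _ _ hb).trans_eq ?_)
    rw [nsmul_eq_mul, Finset.card_univ]
  calc c i ^ Fintype.card {k // p k}
      ≤ (Fintype.card {k // p k} * (∑ a, (z a : ℝ) * A a b) ^ 2) ^ Fintype.card {k // p k} :=
        pow_le_pow_left₀ (h.pos i).le hle' _
    _ = (Fintype.card {k // p k} : ℝ) ^ Fintype.card {k // p k} *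
          (|∑ a, (z a : ℝ) * A a b| ^ Fintype.card {k // p k}) ^ 2 := by
        rw [mul_pow, ← sq_abs, ← pow_mul, ← pow_mul, mul_comm 2]
    _ ≤ _ := by
        rw [← hdetsq]
        gcongr
        exact hz b

/-- The logarithm of `IsKorkinZolotarev.pow_card_le`, with the block listed from `j` downwards. -/
theorem IsKorkinZolotarev.mul_log_le {n : ℕ} {U : Matrix (Fin n) (Fin n) ℝ} {c : Fin n → ℝ}
    (h : IsKorkinZolotarev U c) (j : Fin n) {t : ℕ} (ht : t ≤ j) :
    (t + 1) * Real.log (c ⟨j - t, by omega⟩) ≤ (t + 1) * Real.log n +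
      ∑ u ∈ Finset.range (t + 1), Real.log (c ⟨j - u, by omega⟩) := by
  set i : Fin n := ⟨j - t, by omega⟩ with hi
  have hij : i ≤ j := Fin.le_def.2 (by simp [hi])
  have hcard : Fintype.card {k // i ≤ k ∧ k ≤ j} = t + 1 := by
    have h1 : Fintype.card {k // i ≤ k ∧ k ≤ j} = (Finset.Icc i j).card :=
      Fintype.card_of_subtype _ fun k => Finset.mem_Icc
    rw [h1, Fin.card_Icc]
    simp only [hi]
    omega
  have hsum : ∑ k : {k // i ≤ k ∧ k ≤ j}, Real.log (c k) =
      ∑ u ∈ Finset.range (t + 1), Real.log (c ⟨j - u, by omega⟩) := by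
    rw [← Finset.sum_subtype (Finset.Icc i j) (fun k => Finset.mem_Icc) fun k => Real.log (c k)]
    refine Finset.sum_bij' (fun k _ => (j : ℕ) - k) (fun u _ => ⟨j - u, by omega⟩) ?_ ?_ ?_ ?_ ?_
    · intro k hk
      rw [Finset.mem_Icc, Fin.le_def, Fin.le_def] at hk
      simp only [hi] at hk
      rw [Finset.mem_range]
      omega
    · intro u hu
      rw [Finset.mem_range] at hu
      rw [Finset.mem_Icc, Fin.le_def, Fin.le_def]
      simp only [hi]
      omega
    · intro k hk
      rw [Finset.mem_Icc, Fin.le_def, Fin.le_def] at hk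
      ext
      simp only
      omega
    · intro u hu
      rw [Finset.mem_range] at hu
      simp only
      omega
    · intro k hk
      rw [Finset.mem_Icc, Fin.le_def, Fin.le_def] at hk
      congr 2
      ext
      simp only
      omega
  have hpow := Real.log_le_log (pow_pos (h.pos i) _) (h.pow_card_le hij)
  have ht0 : (0 : ℝ) < t + 1 := by positivity
  rw [hcard, Real.log_mul (by positivity) (Finset.prod_pos fun k _ => h.pos _).ne', Real.log_pow,
    Real.log_pow, Real.log_prod fun k _ => (h.pos _).ne', hsum] at hpow
  push_cast at hpow
  refine hpow.trans ?_
  gcongr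
  have : t + 1 ≤ n := by omega
  exact_mod_cast this

/-- The squared Gram-Schmidt norms of a Korkin-Zolotarev reduced basis decay at most by the factor
`n ^ (2 + log n)`. -/
theorem IsKorkinZolotarev.div_le {n : ℕ} {U : Matrix (Fin n) (Fin n) ℝ} {c : Fin n → ℝ}
    (h : IsKorkinZolotarev U c) {i j : Fin n} (hij : i ≤ j) :
    c i / c j ≤ Real.exp ((2 + Real.log n) * Real.log n) := by
  have hn : (1 : ℝ) ≤ n := by
    have := i.pos
    exact_mod_cast this
  have hlog : 0 ≤ Real.log n := Real.log_nonneg hn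
  have hrec := le_mul_one_add_harmonic (M := Real.log n)
    (fun t => Real.log (c ⟨j - t, by omega⟩) - Real.log (c j)) j (by simp) (fun t ht => by
      have h1 := h.mul_log_le j ht
      rw [Finset.sum_range_succ] at h1
      rw [Finset.sum_sub_distrib, Finset.sum_const, Finset.card_range, nsmul_eq_mul]
      linarith) (j - i) (Nat.sub_le _ _)
  have hi : (⟨j - (j - i), by omega⟩ : Fin n) = i := by
    ext
    rw [Fin.le_def] at hij
    simp only
    omega
  rw [← Real.log_le_iff_le_exp (div_pos (h.pos i) (h.pos j)),
    Real.log_div (h.pos i).ne' (h.pos j).ne']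
  by_cases hne : (j - i : ℕ) = 0
  · have : i = j := by
      ext
      rw [Fin.le_def] at hij
      omega
    rw [this, sub_self]
    positivity
  · have h1 := hrec hne
    simp only [hi] at h1
    refine h1.trans ?_
    rw [mul_comm]
    refine mul_le_mul_of_nonneg_right ?_ hlog
    have h2 := harmonic_le_one_add_log (j - i)
    have h3 : Real.log ((j - i : ℕ) : ℝ) ≤ Real.log n := by
      refine Real.log_le_log (by exact_mod_cast Nat.pos_of_ne_zero hne) ?_
      have : (j - i : ℕ) ≤ n := by omega
      exact_mod_cast this
    linarith

/-! ### Unitriangular matrices modulo unimodular integer matrices -/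

theorem map_intCast_mul {l m n : Type*} [Fintype m] (A : Matrix l m ℤ) (B : Matrix m n ℤ) :
    (A * B).map (Int.cast : ℤ → ℝ) = A.map (Int.cast : ℤ → ℝ) * B.map (Int.cast : ℤ → ℝ) :=
  Matrix.map_mul (f := Int.castRingHom ℝ)

theorem abs_mul_apply_le {l m n : Type*} [Fintype m] {A : Matrix l m ℝ} {B : Matrix m n ℝ}
    {a b N : ℝ} (ha : 0 ≤ a) (hb : 0 ≤ b) (hN : (Fintype.card m : ℝ) ≤ N) (hA : ∀ i j, |A i j| ≤ a)
    (hB : ∀ i j, |B i j| ≤ b) (i : l) (j : n) : |(A * B) i j| ≤ N * (a * b) := by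
  rw [Matrix.mul_apply]
  refine (Finset.abs_sum_le_sum_abs _ _).trans ?_
  refine (Finset.sum_le_card_nsmul Finset.univ _ (a * b) fun k _ => ?_).trans ?_
  · rw [abs_mul]
    exact mul_le_mul (hA _ _) (hB _ _) (abs_nonneg _) ha
  · rw [nsmul_eq_mul, Finset.card_univ]
    exact mul_le_mul_of_nonneg_right hN (by positivity)

theorem card_le_of_injective_lt {ι : Type*} [Fintype ι] {r : ι → ℕ} (hr : Function.Injective r)
    {N : ℕ} (h : ∀ i, r i < N) : Fintype.card ι ≤ N := by
  have := Fintype.card_le_of_injective (fun i => (⟨r i, h i⟩ : Fin N))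
    fun i j hij => hr (congrArg Fin.val hij)
  simpa using this

/-- Seysen's reduction of a unitriangular matrix `W` of size at most `2 ^ k`: an integer row
transformation `T` makes the entries of both `T * W` and its inverse `V` at most `2 ^ (k choose 2)`.

The proof halves `W` into `[A, 0; X, D]`. After both diagonal blocks have been reduced, an integer
multiple `Y * A` of the first block row is added to the second, so that the lower left block becomes
`Z * A` with `|Z i j| ≤ 1`; then that of the inverse is `-(D⁻¹ * Z)`. Hence only one bound, and not
two, is multiplied by the size `2 ^ k` of the halves when the size is doubled. The injective rank `r`
in place of an order on the index type lets the induction pass to subtypes. -/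
theorem exists_int_unimodular_mul_le (k : ℕ) : ∀ {ι : Type} [Fintype ι] [DecidableEq ι]
    (r : ι → ℕ), Function.Injective r → (∀ i, r i < 2 ^ k) → ∀ W : Matrix ι ι ℝ,
    (∀ i j, r i < r j → W i j = 0) → (∀ i, W i i = 1) →
    ∃ (T : Matrix ι ι ℤ) (V : Matrix ι ι ℝ), T.det = 1 ∧ V * (T.map (Int.cast : ℤ → ℝ) * W) = 1 ∧
      (∀ i j, r i < r j → (T.map (Int.cast : ℤ → ℝ) * W) i j = 0) ∧
      (∀ i j, r i < r j → V i j = 0) ∧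
      (∀ i j, |(T.map (Int.cast : ℤ → ℝ) * W) i j| ≤ 2 ^ k.choose 2) ∧
      ∀ i j, |V i j| ≤ 2 ^ k.choose 2 := by
  induction k with
  | zero =>
    intro ι _ _ r hr hrk W hW hWd
    have hsub : ∀ i j : ι, i = j := fun i j => hr (by have := hrk i; have := hrk j; omega)
    have hW1 : W = 1 := by
      ext i j
      rw [hsub i j, hWd, Matrix.one_apply_eq]
    refine ⟨1, 1, by simp, ?_⟩
    have h1 : (1 : Matrix ι ι ℤ).map (Int.cast : ℤ → ℝ) * W = 1 := by
      rw [hW1, Matrix.map_one _ Int.cast_zero Int.cast_one, Matrix.one_mul]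
    have h2 : ∀ i j : ι, r i < r j → (1 : Matrix ι ι ℝ) i j = 0 := fun i j hij =>
      absurd (hsub i j) fun h => by rw [h] at hij; exact lt_irrefl _ hij
    have h3 : ∀ i j : ι, |(1 : Matrix ι ι ℝ) i j| ≤ 2 ^ Nat.choose 0 2 := fun i j => by
      rw [hsub i j, Matrix.one_apply_eq]; simp
    rw [h1, Matrix.one_mul]
    exact ⟨rfl, h2, h2, h3, h3⟩
  | succ k ih =>
    intro ι _ _ r hr hrk W hW hWd
    let p : ι → Prop := fun i => r i < 2 ^ k
    let σ : {i // p i} ⊕ {i // ¬p i} ≃ ι := Equiv.sumCompl p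
    let r₁ : {i // p i} → ℕ := fun i => r i
    let r₂ : {i // ¬p i} → ℕ := fun i => r i - 2 ^ k
    have hr₂ : ∀ i : {i // ¬p i}, r i = r₂ i + 2 ^ k := fun i =>
      (Nat.sub_add_cancel (not_lt.1 i.2)).symm
    have hr₁i : Function.Injective r₁ := fun i j hij => Subtype.ext (hr hij)
    have hr₂i : Function.Injective r₂ := fun i j hij =>
      Subtype.ext (hr (by rw [hr₂, hr₂, hij]))
    have hr₁k : ∀ i, r₁ i < 2 ^ k := fun i => i.2
    have hr₂k : ∀ i, r₂ i < 2 ^ k := fun i => by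
      have h1 := hrk i
      have h2 := hr₂ i
      rw [pow_succ] at h1
      omega
    let A : Matrix {i // p i} {i // p i} ℝ := W.submatrix (↑) (↑)
    let X : Matrix {i // ¬p i} {i // p i} ℝ := W.submatrix (↑) (↑)
    let D : Matrix {i // ¬p i} {i // ¬p i} ℝ := W.submatrix (↑) (↑)
    obtain ⟨T₁, V₁, hT₁, hVW₁, hl₁, hlV₁, hb₁, hbV₁⟩ := ih r₁ hr₁i hr₁k A
      (fun i j hij => hW i j hij) (fun i => hWd i)
    obtain ⟨T₂, V₂, hT₂, hVW₂, hl₂, hlV₂, hb₂, hbV₂⟩ := ih r₂ hr₂i hr₂k D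
      (fun i j hij => hW i j (by rw [hr₂, hr₂]; omega)) (fun i => hWd i)
    set A' := T₁.map (Int.cast : ℤ → ℝ) * A
    set D' := T₂.map (Int.cast : ℤ → ℝ) * D
    set X' := T₂.map (Int.cast : ℤ → ℝ) * X
    -- `V₁` is the inverse of `A'`, so `X' * V₁` holds the coordinates of `X'` in the rows of `A'`
    let Y : Matrix {i // ¬p i} {i // p i} ℤ := Matrix.of fun i j => -round ((X' * V₁) i j)
    let Z : Matrix {i // ¬p i} {i // p i} ℝ := Y.map (Int.cast : ℤ → ℝ) + X' * V₁
    have hZ : ∀ i j, |Z i j| ≤ 1 := fun i j => by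
      have h1 := abs_sub_round ((X' * V₁) i j)
      have h2 : Z i j = (X' * V₁) i j - round ((X' * V₁) i j) := by
        simp only [Z, Y, Matrix.add_apply, Matrix.map_apply, Matrix.of_apply, Int.cast_neg]
        ring
      rw [h2]
      linarith
    have hZA : Y.map (Int.cast : ℤ → ℝ) * A' + X' = Z * A' := by
      rw [Matrix.add_mul, Matrix.mul_assoc X', hVW₁, Matrix.mul_one]
    have hWσ : W.submatrix σ σ = Matrix.fromBlocks A 0 X D := by
      ext i j
      rcases i with i | i <;> rcases j with j | j
      · rfl
      · exact hW i j (lt_of_lt_of_le i.2 (not_lt.1 j.2))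
      · rfl
      · rfl
    let T' : Matrix ({i // p i} ⊕ {i // ¬p i}) ({i // p i} ⊕ {i // ¬p i}) ℤ :=
      Matrix.fromBlocks T₁ 0 (Y * T₁) T₂
    let V' : Matrix ({i // p i} ⊕ {i // ¬p i}) ({i // p i} ⊕ {i // ¬p i}) ℝ :=
      Matrix.fromBlocks V₁ 0 (-(V₂ * Z)) V₂
    have hTW' : T'.map (Int.cast : ℤ → ℝ) * W.submatrix σ σ =
        Matrix.fromBlocks A' 0 (Z * A') D' := by
      rw [hWσ, Matrix.fromBlocks_map, Matrix.fromBlocks_multiply, map_intCast_mul,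
        Matrix.mul_assoc (Y.map _), hZA]
      simp [A', D']
    have hTW : (T'.submatrix σ.symm σ.symm).map (Int.cast : ℤ → ℝ) * W =
        (Matrix.fromBlocks A' 0 (Z * A') D').submatrix σ.symm σ.symm := by
      rw [← hTW', ← Matrix.submatrix_mul_equiv _ _ _ σ.symm, Matrix.submatrix_submatrix]
      simp [Matrix.submatrix_map]
    have hVTW : V' * Matrix.fromBlocks A' 0 (Z * A') D' = 1 := by
      rw [Matrix.fromBlocks_multiply, hVW₁, hVW₂]
      simp [Matrix.mul_assoc]
    have hpow : (2 : ℝ) ^ (k + 1).choose 2 = 2 ^ k * 2 ^ k.choose 2 := by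
      rw [Nat.choose_succ_succ' k 1, Nat.choose_one_right, pow_add]
    have hmono : (2 : ℝ) ^ k.choose 2 ≤ 2 ^ (k + 1).choose 2 := by
      rw [hpow]
      exact le_mul_of_one_le_left (by positivity) (one_le_pow₀ one_le_two)
    have hcard₁ : (Fintype.card {i // p i} : ℝ) ≤ 2 ^ k := by
      exact_mod_cast card_le_of_injective_lt hr₁i hr₁k
    have hcard₂ : (Fintype.card {i // ¬p i} : ℝ) ≤ 2 ^ k := by
      exact_mod_cast card_le_of_injective_lt hr₂i hr₂k
    have hbZA : ∀ i j, |(Z * A') i j| ≤ 2 ^ (k + 1).choose 2 := fun i j => by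
      rw [hpow, ← one_mul ((2 : ℝ) ^ k.choose 2)]
      exact abs_mul_apply_le zero_le_one (by positivity) hcard₁ hZ hb₁ i j
    have hbVZ : ∀ i j, |(V₂ * Z) i j| ≤ 2 ^ (k + 1).choose 2 := fun i j => by
      rw [hpow, ← mul_one ((2 : ℝ) ^ k.choose 2)]
      exact abs_mul_apply_le (by positivity) zero_le_one hcard₂ hbV₂ hZ i j
    have hlow : ∀ {M : Matrix {i // p i} {i // p i} ℝ} {N : Matrix {i // ¬p i} {i // ¬p i} ℝ}
        (K : Matrix {i // ¬p i} {i // p i} ℝ), (∀ i j, r₁ i < r₁ j → M i j = 0) →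
        (∀ i j, r₂ i < r₂ j → N i j = 0) → ∀ i j, r i < r j →
        (Matrix.fromBlocks M 0 K N).submatrix σ.symm σ.symm i j = 0 := by
      intro M N K hM hN i j hij
      obtain ⟨i, rfl⟩ := σ.surjective i
      obtain ⟨j, rfl⟩ := σ.surjective j
      rw [Matrix.submatrix_apply, Equiv.symm_apply_apply, Equiv.symm_apply_apply]
      rcases i with i | i <;> rcases j with j | j
      · exact hM i j hij
      · rfl
      · exact absurd (hij.trans j.2) i.2
      · refine hN i j ?_
        have h1 : r i < r j := hij
        rw [hr₂, hr₂] at h1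
        omega
    have hbd : ∀ {M : Matrix {i // p i} {i // p i} ℝ} {N : Matrix {i // ¬p i} {i // ¬p i} ℝ}
        {K : Matrix {i // ¬p i} {i // p i} ℝ}, (∀ i j, |M i j| ≤ 2 ^ k.choose 2) →
        (∀ i j, |N i j| ≤ 2 ^ k.choose 2) → (∀ i j, |K i j| ≤ 2 ^ (k + 1).choose 2) → ∀ i j,
        |(Matrix.fromBlocks M 0 K N).submatrix σ.symm σ.symm i j| ≤ 2 ^ (k + 1).choose 2 := by
      intro M N K hM hN hK i j
      rw [Matrix.submatrix_apply]
      rcases σ.symm i with i | i <;> rcases σ.symm j with j | j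
      · exact (hM i j).trans hmono
      · simp
      · exact hK i j
      · exact (hN i j).trans hmono
    refine ⟨T'.submatrix σ.symm σ.symm, V'.submatrix σ.symm σ.symm, ?_, ?_, ?_, ?_, ?_, ?_⟩
    · rw [Matrix.det_submatrix_equiv_self, Matrix.det_fromBlocks_zero₁₂, hT₁, hT₂, one_mul]
    · rw [hTW, Matrix.submatrix_mul_equiv, hVTW, Matrix.submatrix_one_equiv]
    · rw [hTW]
      exact hlow _ hl₁ hl₂
    · exact hlow _ hlV₁ hlV₂
    · rw [hTW]
      exact hbd hb₁ hb₂ hbZA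
    · exact hbd hbV₁ hbV₂ fun i j => by rw [Matrix.neg_apply, abs_neg]; exact hbVZ i j

/-! ### The Seysen measure and Gram matrices -/

theorem rowMatrix_mul_transpose_apply {n m : ℕ} (b : Fin n → EuclideanSpace ℝ (Fin m))
    (i j : Fin n) : (rowMatrix b * (rowMatrix b)ᵀ) i j = inner ℝ (b i) (b j) := by
  simp [rowMatrix, Matrix.mul_apply, PiLp.inner_apply, mul_comm]

theorem posDef_rowMatrix_mul_transpose {n m : ℕ} {b : Fin n → EuclideanSpace ℝ (Fin m)}
    (hb : LinearIndependent ℝ b) : (rowMatrix b * (rowMatrix b)ᵀ).PosDef := by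
  have h : rowMatrix b * (rowMatrix b)ᵀ = Matrix.gram ℝ b := by
    ext i j
    rw [rowMatrix_mul_transpose_apply, Matrix.gram_apply]
  rw [h]
  exact Matrix.posDef_gram_of_linearIndependent hb

theorem norm_dual_sq {n m : ℕ} {b : Fin n → EuclideanSpace ℝ (Fin m)}
    (hb : LinearIndependent ℝ b) (i : Fin n) :
    ‖dual b i‖ ^ 2 = (rowMatrix b * (rowMatrix b)ᵀ)⁻¹ i i := by
  have h : (pinv (rowMatrix b))ᵀ * pinv (rowMatrix b) = (rowMatrix b * (rowMatrix b)ᵀ)⁻¹ := by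
    conv_lhs => rw [pinv, Matrix.transpose_mul, Matrix.transpose_transpose, Matrix.mul_assoc]
    rw [← Matrix.mul_assoc (rowMatrix b), Matrix.mul_nonsing_inv _ (det_gram_pos hb).ne'.isUnit,
      Matrix.mul_one, Matrix.transpose_nonsing_inv, Matrix.transpose_mul,
      Matrix.transpose_transpose]
  rw [← h, Matrix.mul_apply, EuclideanSpace.real_norm_sq_eq]
  exact Finset.sum_congr rfl fun k _ => sq _

theorem seysenMeasure_eq {n m : ℕ} {b : Fin n → EuclideanSpace ℝ (Fin m)}
    (hb : LinearIndependent ℝ b) :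
    seysenMeasure b = ∑ i, (rowMatrix b * (rowMatrix b)ᵀ) i i *
      (rowMatrix b * (rowMatrix b)ᵀ)⁻¹ i i :=
  Finset.sum_congr rfl fun i _ => by
    rw [norm_dual_sq hb, rowMatrix_mul_transpose_apply, real_inner_self_eq_norm_sq]

theorem span_sum_smul_le {n : ℕ} {E : Type*} [AddCommGroup E] [Module ℝ E]
    (P : Matrix (Fin n) (Fin n) ℤ) (b : Fin n → E) :
    Submodule.span ℤ (Set.range fun i => ∑ j, (P i j : ℝ) • b j) ≤
      Submodule.span ℤ (Set.range b) := by
  rw [Submodule.span_le]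
  rintro _ ⟨i, rfl⟩
  refine Submodule.sum_mem _ fun j _ => ?_
  rw [Int.cast_smul_eq_zsmul]
  exact Submodule.smul_mem _ _ (Submodule.subset_span ⟨j, rfl⟩)

theorem IsLatticeBasis.sum_smul {n m : ℕ} {L : Submodule ℤ (EuclideanSpace ℝ (Fin m))}
    {b : Fin n → EuclideanSpace ℝ (Fin m)} (hb : IsLatticeBasis L b)
    {P : Matrix (Fin n) (Fin n) ℤ} (hP : IsUnit P.det) :
    IsLatticeBasis L fun i => ∑ j, (P i j : ℝ) • b j := by
  refine ⟨linearIndependent_sum_smul hb.1 (intCast_det_ne_zero hP), ?_⟩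
  rw [← hb.2]
  refine le_antisymm (span_sum_smul_le P b) ?_
  have h : b = fun i => ∑ j, (P⁻¹ i j : ℝ) • ∑ k, (P j k : ℝ) • b k := by
    funext i
    refine .trans ?_ (sum_smul_sum_mul_smul (fun j => (P⁻¹ i j : ℝ))
      (P.map (Int.cast : ℤ → ℝ)) b).symm
    have h1 : ∀ k, ∑ j, (P⁻¹ i j : ℝ) * (P j k : ℝ) = if i = k then 1 else 0 := fun k => by
      have h2 := congrFun (congrFun (Matrix.nonsing_inv_mul P hP) i) k
      rw [Matrix.mul_apply, Matrix.one_apply] at h2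
      exact_mod_cast h2
    simp [h1]
  calc Submodule.span ℤ (Set.range b)
      = Submodule.span ℤ (Set.range fun i => ∑ j, (P⁻¹ i j : ℝ) • ∑ k, (P j k : ℝ) • b k) := by
        rw [← h]
    _ ≤ _ := span_sum_smul_le _ _

/-! ### A basis of small Seysen measure -/

/-- The left side is the Seysen measure of the basis `∑ j, W i j • eⱼ` with `eⱼ` orthogonal,
`c j = ‖eⱼ‖²` and `V = W⁻¹`. Since `W` and `V` are lower triangular, `c j / c k` occurs only for
`j ≤ k`, where it is at most `α`. -/
theorem sum_mul_sum_le {n : ℕ} {W V : Matrix (Fin n) (Fin n) ℝ} {c : Fin n → ℝ} {ζ α : ℝ}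
    (hc : ∀ i, 0 < c i) (hα : ∀ i j, i ≤ j → c i / c j ≤ α) (hα0 : 0 ≤ α)
    (hW : ∀ i j, i < j → W i j = 0) (hV : ∀ i j, i < j → V i j = 0)
    (hWb : ∀ i j, |W i j| ≤ ζ) (hVb : ∀ i j, |V i j| ≤ ζ) :
    ∑ i, (∑ j, W i j ^ 2 * c j) * (∑ k, V k i ^ 2 * (c k)⁻¹) ≤ n ^ 3 * (ζ ^ 4 * α) := by
  have hterm : ∀ i j k, W i j ^ 2 * c j * (V k i ^ 2 * (c k)⁻¹) ≤ ζ ^ 4 * α := fun i j k => by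
    have h0 : 0 ≤ ζ ^ 4 * α := by positivity
    rcases lt_or_ge i j with hij | hij
    · simpa [hW i j hij] using h0
    rcases lt_or_ge k i with hki | hki
    · simpa [hV k i hki] using h0
    have h1 := sq_le_sq' (neg_le_of_abs_le (hWb i j)) (le_of_abs_le (hWb i j))
    have h2 := sq_le_sq' (neg_le_of_abs_le (hVb k i)) (le_of_abs_le (hVb k i))
    have h3 : 0 ≤ c j / c k := (div_pos (hc j) (hc k)).le
    calc W i j ^ 2 * c j * (V k i ^ 2 * (c k)⁻¹) = W i j ^ 2 * V k i ^ 2 * (c j / c k) := by ring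
      _ ≤ ζ ^ 2 * ζ ^ 2 * α := by
        gcongr
        exact hα j k (hij.trans hki)
      _ = ζ ^ 4 * α := by ring
  calc ∑ i, (∑ j, W i j ^ 2 * c j) * (∑ k, V k i ^ 2 * (c k)⁻¹)
      = ∑ i, ∑ j, ∑ k, W i j ^ 2 * c j * (V k i ^ 2 * (c k)⁻¹) := by
        simp_rw [Finset.sum_mul_sum]
    _ ≤ ∑ _i : Fin n, ∑ _j : Fin n, ∑ _k : Fin n, ζ ^ 4 * α :=
        Finset.sum_le_sum fun i _ => Finset.sum_le_sum fun j _ => Finset.sum_le_sum fun k _ =>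
          hterm i j k
    _ = n ^ 3 * (ζ ^ 4 * α) := by
        simp only [Finset.sum_const, Finset.card_univ, Fintype.card_fin, nsmul_eq_mul]
        ring

/-- A Korkin-Zolotarev reduced basis, transformed such that its coordinates in the Gram-Schmidt
vectors and the inverse of their matrix are small, has a small Seysen measure. -/
theorem IsLatticeBasis.exists_seysenMeasure_le {n m : ℕ}
    {L : Submodule ℤ (EuclideanSpace ℝ (Fin m))} {b : Fin n → EuclideanSpace ℝ (Fin m)}
    (hb : IsLatticeBasis L b) :
    ∃ b' : Fin n → EuclideanSpace ℝ (Fin m), IsLatticeBasis L b' ∧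
      seysenMeasure b' ≤ n ^ 3 * (((2 : ℝ) ^ (Nat.clog 2 n).choose 2) ^ 4 *
        Real.exp ((2 + Real.log n) * Real.log n)) := by
  obtain ⟨P, U, e, hP, hU, he, -, hPU⟩ := exists_isKorkinZolotarev hb.1
  obtain ⟨T, V, hT, hVW, hWl, hVl, hWb, hVb⟩ := exists_int_unimodular_mul_le (Nat.clog 2 n)
    (fun i : Fin n => (i : ℕ)) Fin.val_injective
    (fun i => i.2.trans_le (Nat.le_pow_clog one_lt_two n)) U (fun i j hij => hU.lower i j hij)
    hU.diag
  set W := T.map (Int.cast : ℤ → ℝ) * U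
  set b' : Fin n → EuclideanSpace ℝ (Fin m) :=
    fun i => ∑ j, (T i j : ℝ) • ∑ k, (P j k : ℝ) • b k with hb'
  have hlat : IsLatticeBasis L b' := (hb.sum_smul hP).sum_smul (by rw [hT]; exact isUnit_one)
  have hWe : ∀ i, b' i = ∑ j, W i j • e j := fun i => by
    simp only [hb', hPU]
    exact sum_smul_sum_mul_smul (fun j => (T i j : ℝ)) U e
  have hrow : rowMatrix b' = W * rowMatrix e := by
    ext i k
    simp [rowMatrix, hWe, Matrix.mul_apply]
  have hdiag : rowMatrix e * (rowMatrix e)ᵀ = Matrix.diagonal fun i => ‖e i‖ ^ 2 := by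
    ext i j
    rw [rowMatrix_mul_transpose_apply]
    by_cases hij : i = j
    · rw [hij, Matrix.diagonal_apply_eq, real_inner_self_eq_norm_sq]
    · rw [Matrix.diagonal_apply_ne _ hij, he hij]
  have hG : rowMatrix b' * (rowMatrix b')ᵀ = W * Matrix.diagonal (fun i => ‖e i‖ ^ 2) * Wᵀ := by
    rw [hrow, Matrix.transpose_mul, ← hdiag]
    simp only [Matrix.mul_assoc]
  have hG' : (rowMatrix b' * (rowMatrix b')ᵀ)⁻¹ =
      Vᵀ * Matrix.diagonal (fun i => (‖e i‖ ^ 2)⁻¹) * V := by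
    refine Matrix.inv_eq_left_inv ?_
    have h1 : Matrix.diagonal (fun i => (‖e i‖ ^ 2)⁻¹) *
        Matrix.diagonal (fun i => ‖e i‖ ^ 2) = 1 := by
      rw [Matrix.diagonal_mul_diagonal, ← Matrix.diagonal_one]
      exact congrArg _ (funext fun i => inv_mul_cancel₀ (hU.pos i).ne')
    calc _ = Vᵀ * (Matrix.diagonal (fun i => (‖e i‖ ^ 2)⁻¹) * (V * W) *
          Matrix.diagonal (fun i => ‖e i‖ ^ 2)) * Wᵀ := by
          rw [hG]
          simp only [Matrix.mul_assoc]
      _ = (W * V)ᵀ := by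
          rw [hVW, Matrix.mul_one, h1, Matrix.mul_one, Matrix.transpose_mul W V]
      _ = 1 := by rw [mul_eq_one_comm.1 hVW, Matrix.transpose_one]
  refine ⟨b', hlat, ?_⟩
  rw [seysenMeasure_eq hlat.1]
  refine le_trans (le_of_eq ?_) (sum_mul_sum_le hU.pos (fun i j hij => hU.div_le hij)
    (Real.exp_pos _).le hWl hVl hWb hVb)
  refine Finset.sum_congr rfl fun i _ => ?_
  rw [hG', hG]
  congr 1
  · rw [Matrix.mul_apply]
    refine Finset.sum_congr rfl fun j _ => ?_
    rw [Matrix.mul_diagonal, Matrix.transpose_apply]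
    ring
  · rw [Matrix.mul_apply]
    refine Finset.sum_congr rfl fun j _ => ?_
    rw [Matrix.mul_diagonal, Matrix.transpose_apply]
    ring

/-- Since `k = clog 2 n` satisfies `(k - 1) log 2 ≤ log n`, the power `2 ^ (4 (k choose 2))` contributes
`2 / log 2` to the coefficient of `(log n)²`. -/
theorem choose_clog_mul_log_le (n : ℕ) :
    4 * (((Nat.clog 2 n).choose 2 : ℕ) * Real.log 2) ≤
      2 * (1 / Real.log 2) * Real.log n ^ 2 + 2 * Real.log n := by
  have hl2 : 0 < Real.log 2 := Real.log_pos one_lt_two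
  have hln : 0 ≤ Real.log n := Real.log_natCast_nonneg n
  rcases le_or_gt n 1 with hn | hn
  · rw [Nat.clog_of_right_le_one hn]
    simp only [Nat.choose_zero_succ, Nat.cast_zero, zero_mul, mul_zero]
    positivity
  · set k := Nat.clog 2 n
    have hk : ((k : ℝ) - 1) * Real.log 2 ≤ Real.log n := by
      have h1 : 2 ^ (k - 1) < n := Nat.pow_pred_clog_lt_self one_lt_two hn
      have h2 : (2 : ℝ) ^ (k - 1) ≤ n := by exact_mod_cast h1.le
      have h3 := Real.log_le_log (by positivity) h2
      rwa [Real.log_pow, Nat.cast_sub (Nat.clog_pos one_lt_two hn), Nat.cast_one] at h3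
    have hk1 : (k : ℝ) ≤ 1 / Real.log 2 * Real.log n + 1 := by
      have h1 : (k : ℝ) - 1 ≤ Real.log n / Real.log 2 := (le_div_iff₀ hl2).2 hk
      rw [one_div_mul_eq_div]
      linarith
    calc 4 * ((k.choose 2 : ℕ) * Real.log 2) = 2 * (k * (((k : ℝ) - 1) * Real.log 2)) := by
          rw [Nat.cast_choose_two]
          ring
      _ ≤ 2 * ((1 / Real.log 2 * Real.log n + 1) * Real.log n) := by
          have hk0 : (1 : ℝ) ≤ k := by exact_mod_cast Nat.clog_pos one_lt_two hn
          refine mul_le_mul_of_nonneg_left (mul_le_mul hk1 hk ?_ (by positivity)) zero_le_two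
          exact mul_nonneg (sub_nonneg.2 hk0) hl2.le
      _ = _ := by ring

/-! ### The shortest vector of a basis and its Seysen measure -/

theorem iInf_norm_pow_le {n m : ℕ} (hn : n ≠ 0) {b : Fin n → EuclideanSpace ℝ (Fin m)}
    (hb : LinearIndependent ℝ b) :
    ((⨅ i, ‖b i‖) ^ n) ^ 2 ≤ (seysenMeasure b / n) ^ n * vol b ^ 2 := by
  have hdet := det_gram_pos hb
  rw [vol, Real.sq_sqrt hdet.le, seysenMeasure_eq hb]
  refine le_trans ?_ (prod_diag_le hn (posDef_rowMatrix_mul_transpose hb))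
  have h0 : 0 ≤ ⨅ i, ‖b i‖ := Real.iInf_nonneg fun i => norm_nonneg _
  calc ((⨅ i, ‖b i‖) ^ n) ^ 2 = ∏ _i : Fin n, (⨅ i, ‖b i‖) ^ 2 := by
        rw [Finset.prod_const, Finset.card_univ, Fintype.card_fin, ← pow_mul, ← pow_mul, mul_comm]
    _ ≤ ∏ i, (rowMatrix b * (rowMatrix b)ᵀ) i i := by
        refine Finset.prod_le_prod (fun _ _ => sq_nonneg _) fun i _ => ?_
        rw [rowMatrix_mul_transpose_apply, real_inner_self_eq_norm_sq]
        exact pow_le_pow_left₀ h0 (ciInf_le (Set.finite_range _).bddBelow i) 2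

end Seysen

theorem proposition3p7 :
    ∃ C : ℝ, ∀ (n m : ℕ), 1 ≤ n →
      ∀ (L : Submodule ℤ (EuclideanSpace ℝ (Fin m))) (b : Fin n → EuclideanSpace ℝ (Fin m)),
        Seysen.IsSeysenReduced L b →
          (⨅ i, ‖b i‖) ≤
            Real.exp ((1 / Real.log 2 + 1 / 2) * Real.log n ^ 2 + C * Real.log n) *
              Seysen.vol b ^ (1 / n : ℝ) := by
  refine ⟨3, fun n m hn L b hb => ?_⟩
  have hn0 : n ≠ 0 := by omega
  have hnpos : (0 : ℝ) < n := by exact_mod_cast hn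
  obtain ⟨b', hb', hle⟩ := hb.1.exists_seysenMeasure_le
  have hS0 : 0 ≤ Seysen.seysenMeasure b / n :=
    div_nonneg (Finset.sum_nonneg fun i _ => by positivity) hnpos.le
  set R := Real.exp ((1 / Real.log 2 + 1 / 2) * Real.log n ^ 2 + 3 * Real.log n)
  have hS : Seysen.seysenMeasure b / n ≤ R ^ 2 := by
    rw [div_le_iff₀ hnpos]
    refine (hb.2 b' hb').trans (hle.trans ?_)
    have hexp : ∀ {x : ℝ}, 0 < x → ∀ k : ℕ, x ^ k = Real.exp (k * Real.log x) :=
      fun hx k => by rw [Real.exp_nat_mul, Real.exp_log hx]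
    have h2 : ((2 : ℝ) ^ (Nat.clog 2 n).choose 2) ^ 4 =
        Real.exp (4 * (((Nat.clog 2 n).choose 2 : ℕ) * Real.log 2)) := by
      rw [← Real.log_pow]
      exact hexp (by positivity) 4
    have h3 : R ^ 2 * n = n ^ 3 * (Real.exp (2 * (1 / Real.log 2) * Real.log n ^ 2 +
        2 * Real.log n) * Real.exp ((2 + Real.log n) * Real.log n)) := by
      have h4 : (n : ℝ) ^ 2 = Real.exp (2 * Real.log n) := hexp hnpos 2
      rw [pow_succ (n : ℝ) 2, h4, ← Real.exp_nat_mul, ← Real.exp_add, mul_right_comm,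
        ← Real.exp_add]
      congr 2
      push_cast
      ring
    rw [h2, h3]
    gcongr
    exact Seysen.choose_clog_mul_log_le n
  have hv0 : 0 ≤ Seysen.vol b := Real.sqrt_nonneg _
  refine le_of_pow_le_pow_left₀ hn0 (by positivity) ?_
  rw [mul_pow, one_div, Real.rpow_inv_natCast_pow hv0 hn0]
  refine le_of_pow_le_pow_left₀ two_ne_zero (by positivity) ?_
  refine (Seysen.iInf_norm_pow_le hn0 hb.1.1).trans ?_
  rw [mul_pow, ← pow_mul, mul_comm n, pow_mul]
  gcongr
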